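/- Let $X_1,X_2,\dots$ be independent, identically distributed real-valued random variables on a probability space, let $S(0)=0$ and $S(n)=X_1+\dots+X_n$ for $n\ge 1$, and let $$\tau_0:=\inf\{n\ge 1:\ S(n)\le 0\}\in\{1,2,\dots\}\cup\{\infty\},\qquad \inf\emptyset:=\infty .$$ Assume that $\mathbf P(S(n)>0)\to\varrho$ as $n\to\infty$ for some $\varrho\in(0,1)$. Then there exists a slowly varying function $\ell$ such that $$\mathbf P(\tau_0>n)=n^{\varrho-1}\ell(n)\qquad\text{for every integer } n\ge 1 .$$ Here $\ell$ is called slowly varying if it is a measurable real function, positive on $(0,\infty)$, with $\lim_{x\to\infty}\ell(cx)/\ell(x)=1$ for every $c>0$. -/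

import Mathlib

open MeasureTheory ProbabilityTheory Filter Topology

/-- The random walk `S(n) = X₁ + ⋯ + Xₙ`, `S(0) = 0`. The increments are indexed from zero:
`X i` is the `(i + 1)`-st increment. -/
def walk {Ω : Type*} (X : ℕ → Ω → ℝ) (n : ℕ) (ω : Ω) : ℝ :=
  ∑ i ∈ Finset.range n, X i ω

/-- The stopping time `τ_x = inf {n ≥ 1 : x + S(n) ≤ 0}`, equal to `⊤` if there is no such `n`. -/
noncomputable def exitTime {Ω : Type*} (X : ℕ → Ω → ℝ) (x : ℝ) : Ω → WithTop ℕ :=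
  hittingAfter (fun n ω => x + walk X n ω) (Set.Iic 0) 1

/-- `ℓ` is slowly varying at infinity: it is measurable, positive on `(0, ∞)`, and
`ℓ(c x) / ℓ(x) → 1` as `x → ∞` for every fixed `c > 0`. -/
structure SlowlyVarying (ℓ : ℝ → ℝ) : Prop where
  measurable : Measurable ℓ
  pos : ∀ x : ℝ, 0 < x → 0 < ℓ x
  tendsto_ratio : ∀ c : ℝ, 0 < c → Tendsto (fun x : ℝ => ℓ (c * x) / ℓ x) atTop (𝓝 1)

/-!
The proof combines an identity of Sparre Andersen with an elementary argument on increments; no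
Tauberian theorem is needed.

Write `q(n) = P(τ₀ > n) = P(S(1) > 0, …, S(n) > 0)` and `p(n) = P(S(n) > 0)`. On reversing time,
`q(n)` is the probability that `n` is a strict ascending ladder epoch (`measureReal_staysPositive`).
If `f(j)` is the probability that the first ladder epoch is `j`, then `q = δ₀ + f * q` by the renewal
property (`recordProb_eq_sum`). Moreover `p(n) = ∑ j f(j) q(n - j)` (`measureReal_partialSum_pos`):
a path with `S(n) > 0` is cut at its first maximum and the two parts are exchanged, which gives a
path with a record at `n` that stays non-positive up to the place of the cut; summing over this
place counts each path with a record at `n` as many times as its first ladder epoch indicates.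
Differentiating the generating functions turns the two relations into
`n q(n) = ∑ p(n - j) q(j)` (`natCast_mul_recordProb`).

Put `U(n) = q(0) + ⋯ + q(n - 1)`. The recursion with `p → ϱ > 0` gives `n q(n) ≥ ϱ / 2` eventually,
so `U → ∞`, and the recursion then yields `n q(n) / U(n) → ϱ` (`tendsto_natCast_mul_div_sum`). Since
`q(n) = U(n + 1) - U(n)`, the sequence `log U(n) - ϱ log n` has increments `o(1 / n)`; hence
`n ^ (1 - ϱ) q(n)`, which is `ϱ U(n) n ^ (-ϱ)` up to a factor tending to one, is slowly varying
(`exists_slowlyVarying_of_tendsto`).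
-/

/-! ### Partial sums of a path and their rearrangements -/

/-- The `n`-th partial sum of the path `x`. -/
def partialSum (x : ℕ → ℝ) (n : ℕ) : ℝ := ∑ i ∈ Finset.range n, x i

@[simp] lemma partialSum_zero (x : ℕ → ℝ) : partialSum x 0 = 0 := by simp [partialSum]

lemma partialSum_succ (x : ℕ → ℝ) (n : ℕ) : partialSum x (n + 1) = partialSum x n + x n :=
  Finset.sum_range_succ _ _

lemma partialSum_congr {x y : ℕ → ℝ} {n : ℕ} (h : ∀ i < n, x i = y i) :
    partialSum x n = partialSum y n :=
  Finset.sum_congr rfl fun i hi => h i (Finset.mem_range.1 hi)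

lemma partialSum_shift (x : ℕ → ℝ) (m j : ℕ) :
    partialSum (fun i => x (m + i)) j = partialSum x (m + j) - partialSum x m := by
  simp [partialSum, Finset.sum_range_add]

lemma measurable_partialSum (n : ℕ) : Measurable fun x : ℕ → ℝ => partialSum x n := by
  unfold partialSum
  fun_prop

/-- The partial sums with index `1, …, n` are all positive. -/
def StaysPositive (n : ℕ) (x : ℕ → ℝ) : Prop := ∀ j, 1 ≤ j → j ≤ n → 0 < partialSum x j

/-- `n` is a strict ascending ladder epoch: the `n`-th partial sum exceeds all earlier ones. -/
def IsRecord (n : ℕ) (x : ℕ → ℝ) : Prop := ∀ j < n, partialSum x j < partialSum x n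

/-- `n` is the first index with a positive partial sum, that is, the first strict ascending ladder
epoch. Index `0` never qualifies. -/
def IsFirstPositive (n : ℕ) (x : ℕ → ℝ) : Prop :=
  (∀ i < n, partialSum x i ≤ 0) ∧ 0 < partialSum x n

/-- Among the indices `0, …, n`, the partial sums are maximal at `m`, and for the first time. -/
def IsFirstMax (n m : ℕ) (x : ℕ → ℝ) : Prop :=
  (∀ i < m, partialSum x i < partialSum x m) ∧ ∀ i ≤ n, partialSum x i ≤ partialSum x m

lemma measurableSet_staysPositive (n : ℕ) : MeasurableSet {x | StaysPositive n x} := by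
  simp only [StaysPositive, Set.ofPred_forall]
  exact .iInter fun j => .iInter fun _ => .iInter fun _ =>
    measurableSet_lt measurable_const (measurable_partialSum j)

lemma measurableSet_isRecord (n : ℕ) : MeasurableSet {x | IsRecord n x} := by
  simp only [IsRecord, Set.ofPred_forall]
  exact .iInter fun j => .iInter fun _ =>
    measurableSet_lt (measurable_partialSum j) (measurable_partialSum n)

lemma measurableSet_forall_partialSum_nonpos (n : ℕ) :
    MeasurableSet {x : ℕ → ℝ | ∀ i < n, partialSum x i ≤ 0} := by
  simp only [Set.ofPred_forall]
  exact .iInter fun j => .iInter fun _ =>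
    measurableSet_le (measurable_partialSum j) measurable_const

lemma measurableSet_partialSum_pos (n : ℕ) : MeasurableSet {x : ℕ → ℝ | 0 < partialSum x n} :=
  measurableSet_lt measurable_const (measurable_partialSum n)

lemma measurableSet_isFirstPositive (n : ℕ) : MeasurableSet {x | IsFirstPositive n x} :=
  (measurableSet_forall_partialSum_nonpos n).inter (measurableSet_partialSum_pos n)

lemma measurableSet_isFirstMax (n m : ℕ) : MeasurableSet {x | IsFirstMax n m x} := by
  simp only [IsFirstMax, Set.ofPred_and, Set.ofPred_forall]
  exact (MeasurableSet.iInter fun j => .iInter fun _ =>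
    measurableSet_lt (measurable_partialSum j) (measurable_partialSum m)).inter
    (.iInter fun j => .iInter fun _ =>
    measurableSet_le (measurable_partialSum j) (measurable_partialSum m))

/-- The reversal of the indices below `n`. -/
def reverseBelow (n i : ℕ) : ℕ := if i < n then n - 1 - i else i

lemma reverseBelow_injective (n : ℕ) : (reverseBelow n).Injective := by
  intro i j h
  unfold reverseBelow at h
  split_ifs at h <;> omega

lemma partialSum_reverseBelow (x : ℕ → ℝ) {n j : ℕ} (h : j ≤ n) :
    partialSum (fun i => x (reverseBelow n i)) j = partialSum x n - partialSum x (n - j) := by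
  induction j with
  | zero => simp
  | succ j ih =>
    have h1 : n - j = n - (j + 1) + 1 := by omega
    have h2 : reverseBelow n j = n - (j + 1) := by rw [reverseBelow, if_pos (by omega)]; omega
    rw [partialSum_succ, ih (by omega), h1, partialSum_succ, h2]
    ring

lemma staysPositive_reverseBelow (x : ℕ → ℝ) (n : ℕ) :
    StaysPositive n (fun i => x (reverseBelow n i)) ↔ IsRecord n x := by
  constructor
  · intro h j hj
    have := h (n - j) (by omega) (by omega)
    rw [partialSum_reverseBelow x (by omega), show n - (n - j) = j by omega] at this
    linarith
  · intro h j h1 h2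
    rw [partialSum_reverseBelow x h2]
    linarith [h (n - j) (by omega)]

/-- The cyclic rotation of the indices below `k + m` which moves the first `m` of them to the
end. -/
def rotateBelow (k m i : ℕ) : ℕ := if i < k then m + i else if i < k + m then i - k else i

lemma rotateBelow_injective (k m : ℕ) : (rotateBelow k m).Injective := by
  intro i j h
  unfold rotateBelow at h
  split_ifs at h <;> omega

lemma partialSum_rotateBelow_left (x : ℕ → ℝ) {k j : ℕ} (m : ℕ) (h : j ≤ k) :
    partialSum (fun i => x (rotateBelow k m i)) j = partialSum x (m + j) - partialSum x m := by
  rw [← partialSum_shift]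
  exact partialSum_congr fun i hi => by rw [rotateBelow, if_pos (by omega)]

lemma partialSum_rotateBelow_right (x : ℕ → ℝ) (k : ℕ) {m j : ℕ} (h : j ≤ m) :
    partialSum (fun i => x (rotateBelow k m i)) (k + j) =
      partialSum x (m + k) - partialSum x m + partialSum x j := by
  have h1 : partialSum (fun i => x (rotateBelow k m (k + i))) j = partialSum x j :=
    partialSum_congr fun i hi => by
      rw [rotateBelow, if_neg (by omega), if_pos (by omega), show k + i - k = i by omega]
  have h2 := partialSum_shift (fun i => x (rotateBelow k m i)) k j
  rw [h1, partialSum_rotateBelow_left x m le_rfl] at h2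
  linarith

/-- Cutting a path with positive total at its first maximum and exchanging the two parts produces
exactly the paths that end in a record and stay non-positive up to the place of the cut. -/
lemma rotateBelow_isRecord_iff (x : ℕ → ℝ) {k m : ℕ} (hm : 0 < m) :
    ((∀ i < k + 1, partialSum (fun i => x (rotateBelow k m i)) i ≤ 0) ∧
        IsRecord (k + m) (fun i => x (rotateBelow k m i))) ↔
      (0 < partialSum x (k + m) ∧ IsFirstMax (k + m) m x) := by
  have hr := fun {j} (h : j ≤ m) => partialSum_rotateBelow_right x k h
  have hl := fun {j} (h : j ≤ k) => partialSum_rotateBelow_left x m h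
  have hend := hr le_rfl
  rw [add_comm m k] at hr hend
  constructor
  · rintro ⟨h1, h2⟩
    have hlt : ∀ i < m, partialSum x i < partialSum x m := by
      intro i hi
      have := h2 (k + i) (by omega)
      rw [hr hi.le, hend] at this
      linarith
    refine ⟨?_, hlt, fun i hi => ?_⟩
    · have := h2 0 (by omega)
      rw [hend, partialSum_zero] at this
      linarith
    · rcases lt_or_ge i m with h | h
      · exact (hlt i h).le
      · have := h1 (i - m) (by omega)
        rw [hl (by omega), show m + (i - m) = i by omega] at this
        linarith
  · rintro ⟨h1, h2, h3⟩
    have hle : ∀ i < k + 1, partialSum (fun i => x (rotateBelow k m i)) i ≤ 0 := by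
      intro i hi
      rw [hl (by omega)]
      linarith [h3 (m + i) (by omega)]
    refine ⟨hle, fun j hj => ?_⟩
    rcases lt_or_ge j (k + 1) with h | h
    · rw [hend]
      linarith [hle j h]
    · have h4 := hr (j := j - k) (by omega)
      rw [show k + (j - k) = j by omega] at h4
      rw [h4, hend]
      linarith [h2 (j - k) (by omega)]

lemma exists_isFirstMax {n : ℕ} {x : ℕ → ℝ} (h : 0 < partialSum x n) :
    ∃ m, 0 < m ∧ m ≤ n ∧ IsFirstMax n m x := by
  classical
  obtain ⟨a, ha, hmax⟩ := Finset.exists_max_image (Finset.range (n + 1)) (partialSum x)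
    ⟨0, by simp⟩
  have hex : ∃ m, m ≤ n ∧ ∀ i ≤ n, partialSum x i ≤ partialSum x m :=
    ⟨a, by simpa [Nat.lt_succ_iff] using ha,
      fun i hi => hmax i (by simpa [Nat.lt_succ_iff] using hi)⟩
  obtain ⟨hmn, hm⟩ := Nat.find_spec hex
  have hfirst := fun i => Nat.find_min hex (m := i)
  set m := Nat.find hex
  refine ⟨m, Nat.pos_of_ne_zero fun h0 => ?_, hmn, fun i hi => ?_, hm⟩
  · have := hm n le_rfl
    rw [h0, partialSum_zero] at this
    linarith
  · by_contra! hc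
    exact hfirst i hi ⟨by omega, fun j hj => (hm j hj).trans hc⟩

lemma IsFirstMax.unique {n m m' : ℕ} {x : ℕ → ℝ} (hm : m ≤ n) (hm' : m' ≤ n)
    (h : IsFirstMax n m x) (h' : IsFirstMax n m' x) : m = m' := by
  rcases lt_trichotomy m m' with hlt | heq | hlt
  · linarith [h'.1 m hlt, h.2 m' hm']
  · exact heq
  · linarith [h.1 m' hlt, h'.2 m hm]

lemma IsFirstPositive.unique {j j' : ℕ} {x : ℕ → ℝ} (h : IsFirstPositive j x)
    (h' : IsFirstPositive j' x) : j = j' := by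
  rcases lt_trichotomy j j' with hlt | heq | hlt
  · linarith [h'.1 j hlt, h.2]
  · exact heq
  · linarith [h.1 j' hlt, h'.2]

lemma exists_isFirstPositive {n : ℕ} {x : ℕ → ℝ} (h : 0 < partialSum x n) :
    ∃ j ≤ n, IsFirstPositive j x := by
  classical
  have hex : ∃ j, 0 < partialSum x j := ⟨n, h⟩
  exact ⟨Nat.find hex, Nat.find_min' hex h, fun i hi => not_lt.1 (Nat.find_min hex hi),
    Nat.find_spec hex⟩

/-- After the first ladder epoch `j`, the ladder epochs are those of the shifted path. -/
lemma IsFirstPositive.isRecord_iff {n j : ℕ} {x : ℕ → ℝ} (h : IsFirstPositive j x) (hj : j ≤ n) :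
    IsRecord n x ↔ IsRecord (n - j) (fun i => x (j + i)) := by
  simp only [IsRecord, partialSum_shift, show j + (n - j) = n by omega]
  constructor
  · intro hr i hi
    linarith [hr (j + i) (by omega)]
  · intro hr i hi
    have key : ∀ i', j ≤ i' → i' < n → partialSum x i' < partialSum x n := by
      intro i' h1 h2
      have := hr (i' - j) (by omega)
      rw [show j + (i' - j) = i' by omega] at this
      linarith
    rcases lt_or_ge i j with hij | hij
    · have h1 := h.1 i hij
      have h2 := h.2
      rcases eq_or_lt_of_le hj with rfl | hjn
      · linarith
      · linarith [key j le_rfl hjn]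
    · exact key i hij hi

/-! ### Exchangeability and the renewal property of independent identically distributed steps -/

section IID

variable {Ω : Type*} [MeasurableSpace Ω] {P : Measure Ω} {X : ℕ → Ω → ℝ}

/-- The first `j` variables are independent of the later ones. -/
lemma indepFun_truncate_shift (hm : ∀ i, Measurable (X i)) (hi : iIndepFun X P) (j : ℕ) :
    IndepFun (fun ω i => if i < j then X i ω else 0) (fun ω i => X (j + i) ω) P := by
  have hdisj : Disjoint (Set.Iio j) (Set.Ici j) :=
    Set.disjoint_left.2 fun i h1 h2 => absurd (Set.mem_Iio.1 h1) (not_lt.2 h2)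
  have h := indep_iSup_of_disjoint (fun i => (hm i).comap_le) hi.iIndep hdisj
  have hmeas : ∀ (S : Set ℕ) (i : ℕ), i ∈ S →
      Measurable[⨆ i ∈ S, MeasurableSpace.comap (X i) inferInstance] (X i) := fun S i hiS =>
    (comap_measurable (X i)).mono (le_iSup₂_of_le i hiS le_rfl) le_rfl
  rw [IndepFun_iff_Indep]
  refine indep_of_indep_of_le_left (indep_of_indep_of_le_right h ?_) ?_
  · refine Measurable.comap_le ?_
    exact @measurable_pi_lambda _ _ _ (_) _ _ fun i => hmeas _ _ (by simp)
  · refine Measurable.comap_le ?_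
    refine @measurable_pi_lambda _ _ _ (_) _ _ fun i => ?_
    by_cases hij : i < j
    · simp only [hij, if_true]
      exact hmeas _ _ hij
    · simp only [hij, if_false]
      exact measurable_const

/-- The law of an i.i.d. sequence is unchanged when the variables are relabelled injectively. -/
lemma measureReal_relabel (hm : ∀ i, Measurable (X i)) (hi : iIndepFun X P)
    (hd : ∀ i, IdentDistrib (X i) (X 0) P P) {σ : ℕ → ℕ} (hσ : σ.Injective)
    {A : Set (ℕ → ℝ)} (hA : MeasurableSet A) :
    P.real {ω | (fun i => X (σ i) ω) ∈ A} = P.real {ω | (fun i => X i ω) ∈ A} := by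
  have h1 := (hi.precomp hσ).map_fun_eq_infinitePi_map fun i => hm (σ i)
  have h2 := hi.map_fun_eq_infinitePi_map hm
  have h3 : ∀ i, P.map (X i) = P.map (X 0) := fun i => (hd i).map_eq
  simp only [h3] at h1 h2
  have h4 := h1.trans h2.symm
  have h5 := congrArg (fun μ : Measure (ℕ → ℝ) => μ.real A) h4
  rw [map_measureReal_apply (measurable_pi_iff.2 fun i => hm (σ i)) hA,
    map_measureReal_apply (measurable_pi_iff.2 hm) hA] at h5
  exact h5

variable (P X) in
/-- The probability that `n` is a strict ascending ladder epoch. -/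
noncomputable def recordProb (n : ℕ) : ℝ := P.real {ω | IsRecord n fun i => X i ω}

variable (P X) in
/-- The probability that `n` is the first strict ascending ladder epoch. -/
noncomputable def firstPositiveProb (n : ℕ) : ℝ := P.real {ω | IsFirstPositive n fun i => X i ω}

/-- Duality: a record at time `n` becomes, on reversing time, a path that stays positive. -/
lemma measureReal_staysPositive (hm : ∀ i, Measurable (X i)) (hi : iIndepFun X P)
    (hd : ∀ i, IdentDistrib (X i) (X 0) P P) (n : ℕ) :
    P.real {ω | StaysPositive n fun i => X i ω} = recordProb P X n := by
  have h := measureReal_relabel hm hi hd (reverseBelow_injective n) (measurableSet_staysPositive n)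
  refine h.symm.trans ?_
  rw [recordProb]
  congr 1
  ext ω
  exact staysPositive_reverseBelow (fun i => X i ω) n

lemma measureReal_isFirstPositive_isRecord (hm : ∀ i, Measurable (X i)) (hi : iIndepFun X P)
    (hd : ∀ i, IdentDistrib (X i) (X 0) P P) {j n : ℕ} (hj : j ≤ n) :
    P.real {ω | (IsFirstPositive j fun i => X i ω) ∧ IsRecord n fun i => X i ω} =
      firstPositiveProb P X j * recordProb P X (n - j) := by
  have htrunc : ∀ ω, (IsFirstPositive j fun i => X i ω) ↔
      IsFirstPositive j fun i => if i < j then X i ω else 0 := by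
    intro ω
    have h : ∀ i ≤ j, partialSum (fun i => X i ω) i =
        partialSum (fun i => if i < j then X i ω else 0) i := fun i hij =>
      partialSum_congr fun l hl => by rw [if_pos (by omega)]
    simp only [IsFirstPositive, h j le_rfl]
    exact and_congr_left' (forall₂_congr fun i hij => by rw [h i hij.le])
  have hind := (indepFun_truncate_shift hm hi j).measure_inter_preimage_eq_mul _ _
    (measurableSet_isFirstPositive j) (measurableSet_isRecord (n - j))
  have h2 := measureReal_relabel hm hi hd (add_right_injective j) (measurableSet_isRecord (n - j))
  have hset : {ω | (IsFirstPositive j fun i => X i ω) ∧ IsRecord n fun i => X i ω} =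
      (fun ω i => if i < j then X i ω else 0) ⁻¹' {x | IsFirstPositive j x} ∩
        (fun ω i => X (j + i) ω) ⁻¹' {x | IsRecord (n - j) x} := by
    ext ω
    simp only [Set.mem_inter_iff, Set.mem_preimage, Set.mem_ofPred_eq, ← htrunc]
    exact and_congr_right fun h => h.isRecord_iff hj
  have hset1 : {ω | IsFirstPositive j fun i => X i ω} =
      (fun ω i => if i < j then X i ω else 0) ⁻¹' {x | IsFirstPositive j x} := by
    ext ω
    exact htrunc ω
  rw [recordProb, firstPositiveProb, hset1, hset, measureReal_def, hind, ENNReal.toReal_mul]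
  exact congrArg _ h2

variable [IsProbabilityMeasure P]

/-- The measure of an event split according to the value of an index. -/
lemma measureReal_eq_sum_of_unique {s : Finset ℕ} {Q : Set Ω} {R : ℕ → Set Ω}
    (hR : ∀ k ∈ s, MeasurableSet (R k)) (hQ : ∀ ω, ω ∈ Q ↔ ∃ k ∈ s, ω ∈ R k)
    (huniq : ∀ k ∈ s, ∀ k' ∈ s, ∀ ω, ω ∈ R k → ω ∈ R k' → k = k') :
    P.real Q = ∑ k ∈ s, P.real (R k) := by
  have : Q = ⋃ k ∈ s, R k := by
    ext ω
    simp [hQ]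
  rw [this, measureReal_biUnion_finset _ hR]
  exact fun k hk k' hk' hne => Set.disjoint_left.2 fun ω h h' => hne (huniq k hk k' hk' ω h h')

/-- A record at time `n` before which the walk is non-positive up to time `k`, split according to
the first ladder epoch. -/
lemma measureReal_nonpos_isRecord (hm : ∀ i, Measurable (X i)) (hi : iIndepFun X P)
    (hd : ∀ i, IdentDistrib (X i) (X 0) P P) {k n : ℕ} (hk : k < n) :
    P.real {ω | (∀ i < k + 1, partialSum (fun i => X i ω) i ≤ 0) ∧ IsRecord n fun i => X i ω} =
      ∑ j ∈ Finset.range (n + 1) with k < j,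
        firstPositiveProb P X j * recordProb P X (n - j) := by
  have hX : Measurable fun ω i => X i ω := measurable_pi_iff.2 hm
  rw [measureReal_eq_sum_of_unique
    (s := {j ∈ Finset.range (n + 1) | k < j})
    (R := fun j => {ω | (IsFirstPositive j fun i => X i ω) ∧ IsRecord n fun i => X i ω})]
  · refine Finset.sum_congr rfl fun j hj => ?_
    rw [Finset.mem_filter, Finset.mem_range] at hj
    exact measureReal_isFirstPositive_isRecord hm hi hd (by omega)
  · exact fun j _ => hX ((measurableSet_isFirstPositive j).inter (measurableSet_isRecord n))
  · intro ω
    simp only [Set.mem_ofPred_eq, Finset.mem_filter, Finset.mem_range]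
    constructor
    · rintro ⟨h1, h2⟩
      have hpos : 0 < partialSum (fun i => X i ω) n := by simpa using h2 0 (by omega)
      obtain ⟨j, hj, hf⟩ := exists_isFirstPositive hpos
      refine ⟨j, ⟨by omega, ?_⟩, hf, h2⟩
      by_contra! hc
      linarith [h1 j (by omega), hf.2]
    · rintro ⟨j, ⟨-, hkj⟩, hf, h2⟩
      exact ⟨fun i hi => hf.1 i (by omega), h2⟩
  · exact fun j _ j' _ ω h h' => h.1.unique h'.1

/-- The renewal equation of the ladder epochs. -/
lemma recordProb_eq_sum (hm : ∀ i, Measurable (X i)) (hi : iIndepFun X P)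
    (hd : ∀ i, IdentDistrib (X i) (X 0) P P) {n : ℕ} (hn : 0 < n) :
    recordProb P X n =
      ∑ j ∈ Finset.range (n + 1), firstPositiveProb P X j * recordProb P X (n - j) := by
  have h := measureReal_nonpos_isRecord hm hi hd hn
  have h0 : firstPositiveProb P X 0 = 0 := by simp [firstPositiveProb, IsFirstPositive]
  have h1 : {ω | (∀ i < 0 + 1, partialSum (fun i => X i ω) i ≤ 0) ∧ IsRecord n fun i => X i ω} =
      {ω | IsRecord n fun i => X i ω} := by
    ext ω
    simp
  rw [h1] at h
  rw [recordProb, h, Finset.sum_filter_of_ne]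
  rintro j - hj
  refine Nat.pos_of_ne_zero ?_
  rintro rfl
  simp [h0] at hj

/-- The probability of a positive `n`-th sum in terms of the first ladder epoch, by cutting the path
at its first maximum. -/
lemma measureReal_partialSum_pos (hm : ∀ i, Measurable (X i)) (hi : iIndepFun X P)
    (hd : ∀ i, IdentDistrib (X i) (X 0) P P) (n : ℕ) :
    P.real {ω | 0 < partialSum (fun i => X i ω) n} =
      ∑ j ∈ Finset.range (n + 1), j * firstPositiveProb P X j * recordProb P X (n - j) := by
  have hX : Measurable fun ω i => X i ω := measurable_pi_iff.2 hm
  have hsplit : P.real {ω | 0 < partialSum (fun i => X i ω) n} = ∑ k ∈ Finset.range n,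
      P.real {ω | 0 < partialSum (fun i => X i ω) n ∧ IsFirstMax n (n - k) fun i => X i ω} := by
    refine measureReal_eq_sum_of_unique ?_ ?_ ?_
    · exact fun k _ => hX ((measurableSet_partialSum_pos n).inter (measurableSet_isFirstMax n _))
    · intro ω
      simp only [Set.mem_ofPred_eq, Finset.mem_range]
      constructor
      · intro h
        obtain ⟨m, h1, h2, h3⟩ := exists_isFirstMax h
        exact ⟨n - m, by omega, h, by rwa [show n - (n - m) = m by omega]⟩
      · rintro ⟨k, -, h, -⟩
        exact h
    · intro k hk k' hk' ω h h'
      rw [Finset.mem_range] at hk hk'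
      have := h.2.unique (by omega) (by omega) h'.2
      omega
  have hterm : ∀ k ∈ Finset.range n,
      P.real {ω | 0 < partialSum (fun i => X i ω) n ∧ IsFirstMax n (n - k) fun i => X i ω} =
        ∑ j ∈ Finset.range (n + 1),
          if k < j then firstPositiveProb P X j * recordProb P X (n - j) else 0 := by
    intro k hk
    rw [Finset.mem_range] at hk
    rw [← Finset.sum_filter, ← measureReal_nonpos_isRecord hm hi hd hk]
    have h := measureReal_relabel hm hi hd (rotateBelow_injective k (n - k))
      ((measurableSet_forall_partialSum_nonpos (k + 1)).inter (measurableSet_isRecord n))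
    refine Eq.trans ?_ h
    congr 1
    ext ω
    have := rotateBelow_isRecord_iff (fun i => X i ω) (k := k) (m := n - k) (by omega)
    rw [show k + (n - k) = n by omega] at this
    exact this.symm
  rw [hsplit, Finset.sum_congr rfl hterm, Finset.sum_comm]
  refine Finset.sum_congr rfl fun j hj => ?_
  rw [Finset.mem_range] at hj
  have : {k ∈ Finset.range n | k < j} = Finset.range j := by
    ext k
    simp only [Finset.mem_filter, Finset.mem_range]
    omega
  rw [← Finset.sum_filter, this, Finset.sum_const, Finset.card_range, nsmul_eq_mul, mul_assoc]

open PowerSeries in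
/-- The identity of Sparre Andersen, in the form of a recursion: it says that the generating
functions `U` of `recordProb` and `p` of `P(S(n) > 0)` satisfy `s U' = p U`. -/
lemma natCast_mul_recordProb (hm : ∀ i, Measurable (X i)) (hi : iIndepFun X P)
    (hd : ∀ i, IdentDistrib (X i) (X 0) P P) (n : ℕ) :
    n * recordProb P X n = ∑ j ∈ Finset.range (n + 1),
      P.real {ω | 0 < partialSum (fun i => X i ω) (n - j)} * recordProb P X j := by
  set U : ℝ⟦X⟧ := mk (recordProb P X)
  set F : ℝ⟦X⟧ := mk (firstPositiveProb P X)
  set p : ℝ⟦X⟧ := mk fun n => P.real {ω | 0 < partialSum (fun i => X i ω) n}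
  have hcoeff : ∀ (G : ℝ⟦X⟧) (n : ℕ), coeff n (PowerSeries.X * d⁄dX ℝ G) = n * coeff n G := by
    rintro G (_ | n)
    · simp
    · rw [coeff_succ_X_mul, coeff_derivative]
      push_cast
      ring
  have hU : U = 1 + F * U := by
    ext n
    rcases Nat.eq_zero_or_pos n with rfl | hn
    · simp [U, F, recordProb, firstPositiveProb, IsRecord, IsFirstPositive]
    · rw [map_add, coeff_one, if_neg hn.ne', zero_add, coeff_mul,
        Finset.Nat.sum_antidiagonal_eq_sum_range_succ_mk]
      simpa [U, F] using recordProb_eq_sum hm hi hd hn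
  have hp : p = PowerSeries.X * d⁄dX ℝ F * U := by
    ext n
    rw [coeff_mul, Finset.Nat.sum_antidiagonal_eq_sum_range_succ_mk]
    simpa [U, F, p, hcoeff] using measureReal_partialSum_pos hm hi hd n
  have hderiv : PowerSeries.X * d⁄dX ℝ U = p * U := by
    have h1 := congrArg (d⁄dX ℝ) hU
    simp only [map_add, Derivation.leibniz, smul_eq_mul] at h1
    rw [show d⁄dX ℝ (1 : ℝ⟦X⟧) = 0 from derivative_one] at h1
    -- Multiplying `(1 - F) U' = F' U` by `U`, the inverse of `1 - F`.
    linear_combination PowerSeries.X * U * h1 - PowerSeries.X * d⁄dX ℝ U * hU - U * hp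
  have h := congrArg (coeff n) hderiv
  rw [hcoeff, mul_comm p U, coeff_mul, Finset.Nat.sum_antidiagonal_eq_sum_range_succ_mk] at h
  simpa [U, p, mul_comm] using h

end IID

/-! ### Slow variation from small increments -/

/-- Increments bounded by `ε / k` change a sequence over `[m, n]` by at most `ε (n - m) / m`. -/
lemma abs_sub_le_of_increments {V : ℕ → ℝ} {ε : ℝ} {m n : ℕ} (hm : 0 < m) (hmn : m ≤ n)
    (hV : ∀ k ≥ m, |k * (V (k + 1) - V k)| ≤ ε) : |V n - V m| ≤ ε * ((n - m) / m) := by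
  have hm' : (0 : ℝ) < m := by exact_mod_cast hm
  induction n, hmn using Nat.le_induction with
  | base => simp
  | succ n hmn ih =>
    have hmn' : (m : ℝ) ≤ n := by exact_mod_cast hmn
    have hn' : (0 : ℝ) < n := hm'.trans_le hmn'
    have h1 := hV n hmn
    have hε : 0 ≤ ε := (abs_nonneg _).trans h1
    rw [abs_mul, abs_of_pos hn', mul_comm, ← le_div_iff₀ hn'] at h1
    have h2 : ε / n ≤ ε / m := div_le_div_of_nonneg_left hε hm' hmn'
    calc |V (n + 1) - V m| ≤ |V (n + 1) - V n| + |V n - V m| := abs_sub_le _ _ _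
      _ ≤ ε / m + ε * ((n - m) / m) := add_le_add (h1.trans h2) ih
      _ = ε * (((n + 1 : ℕ) - m) / m) := by push_cast; ring

/-- A sequence with increments `o(1 / n)` has vanishing oscillation over ranges `m ≤ n ≤ C m`. -/
lemma tendsto_sub_of_increments {V : ℕ → ℝ}
    (hV : Tendsto (fun n : ℕ => n * (V (n + 1) - V n)) atTop (𝓝 0)) {C : ℝ}
    {ι : Type*} {l : Filter ι} {a b : ι → ℕ} (ha : Tendsto a l atTop) (hb : Tendsto b l atTop)
    (hab : ∀ᶠ i in l, (a i : ℝ) ≤ C * b i) (hba : ∀ᶠ i in l, (b i : ℝ) ≤ C * a i) :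
    Tendsto (fun i => V (a i) - V (b i)) l (𝓝 0) := by
  rw [Metric.tendsto_nhds]
  intro ε hε
  obtain ⟨N, hN⟩ := eventually_atTop.1 (Metric.tendsto_nhds.1 hV (ε / (|C| + 1)) (by positivity))
  have key : ∀ m n : ℕ, N + 1 ≤ m → m ≤ n → (n : ℝ) ≤ C * m → |V n - V m| < ε := by
    intro m n hm hmn hC
    have hm' : (0 : ℝ) < m := by exact_mod_cast (by omega : 0 < m)
    refine (abs_sub_le_of_increments (by omega) hmn fun k hk => ?_).trans_lt
      (?_ : ε / (|C| + 1) * ((n - m) / m) < ε)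
    · simpa [Real.dist_eq] using (hN k (by omega)).le
    · have h1 : ((n : ℝ) - m) / m < |C| + 1 := by
        rw [div_lt_iff₀ hm']
        nlinarith [le_abs_self C]
      calc ε / (|C| + 1) * ((n - m) / m) < ε / (|C| + 1) * (|C| + 1) :=
            mul_lt_mul_of_pos_left h1 (by positivity)
        _ = ε := div_mul_cancel₀ _ (by positivity)
  filter_upwards [ha.eventually_ge_atTop (N + 1), hb.eventually_ge_atTop (N + 1), hab, hba]
    with i h1 h2 h3 h4
  rw [Real.dist_eq, sub_zero]
  rcases le_total (a i) (b i) with h | h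
  · rw [abs_sub_comm]
    exact key _ _ h1 h h4
  · exact key _ _ h2 h h3

/-- If `log L` is the sum of a convergent sequence and a sequence with increments `o(1 / n)`, then
the step function through `L` is slowly varying. -/
lemma slowlyVarying_floor {L V b : ℕ → ℝ} {β : ℝ} (hpos : ∀ n, 0 < L n)
    (hL : ∀ᶠ n in atTop, L n = Real.exp (b n + V n)) (hb : Tendsto b atTop (𝓝 β))
    (hV : Tendsto (fun n : ℕ => n * (V (n + 1) - V n)) atTop (𝓝 0)) :
    SlowlyVarying fun x => L ⌊x⌋₊ where
  measurable := (measurable_of_countable L).comp Nat.measurable_floor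
  pos x _ := hpos _
  tendsto_ratio c hc := by
    have h1 : Tendsto (fun x : ℝ => ⌊x⌋₊) atTop atTop := tendsto_nat_floor_atTop
    have hcx : Tendsto (fun x : ℝ => c * x) atTop atTop := tendsto_id.const_mul_atTop hc
    have h2 : Tendsto (fun x : ℝ => ⌊c * x⌋₊) atTop atTop := h1.comp hcx
    have hfl : ∀ y : ℝ, 1 ≤ y → y / 2 ≤ ⌊y⌋₊ := fun y hy => by
      have h3 : (1 : ℝ) ≤ ⌊y⌋₊ := by exact_mod_cast (Nat.one_le_floor_iff y).2 hy
      linarith [Nat.lt_floor_add_one y]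
    have hVV : Tendsto (fun x : ℝ => V ⌊c * x⌋₊ - V ⌊x⌋₊) atTop (𝓝 0) := by
      refine tendsto_sub_of_increments hV (C := 2 * c + 2 / c) h2 h1 ?_ ?_
      · filter_upwards [eventually_ge_atTop 1] with x hx
        have h3 := hfl x hx
        have h4 : (⌊c * x⌋₊ : ℝ) ≤ c * x := Nat.floor_le (by positivity)
        have h5 : 0 ≤ 2 / c * (⌊x⌋₊ : ℝ) := by positivity
        nlinarith
      · filter_upwards [eventually_ge_atTop 1, hcx.eventually_ge_atTop 1] with x hx hcx
        have h3 := hfl (c * x) hcx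
        have h4 : (⌊x⌋₊ : ℝ) ≤ x := Nat.floor_le (by positivity)
        have h5 : 0 ≤ 2 * c * (⌊c * x⌋₊ : ℝ) := by positivity
        have h6 : x ≤ 2 / c * (⌊c * x⌋₊ : ℝ) := by
          calc x = 2 / c * (c * x / 2) := by field_simp
            _ ≤ _ := by gcongr
        linarith
    have hlim : Tendsto (fun x : ℝ => Real.exp ((b ⌊c * x⌋₊ - b ⌊x⌋₊) +
        (V ⌊c * x⌋₊ - V ⌊x⌋₊))) atTop (𝓝 1) := by
      have := (((hb.comp h2).sub (hb.comp h1)).add hVV).rexp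
      simpa using this
    refine hlim.congr' ?_
    filter_upwards [h1.eventually hL, h2.eventually hL] with x h3 h4
    rw [h3, h4, ← Real.exp_sub]
    congr 1
    ring

/-! ### Asymptotics of the recursion -/

section Recursion

variable {p q : ℕ → ℝ} {ϱ : ℝ}

/-- If `n q(n) = ∑ p(n - j) q(j)` with `p → ϱ > 0`, the left-hand side is bounded below. -/
lemma eventually_le_natCast_mul (hp : Tendsto p atTop (𝓝 ϱ)) (hϱ : 0 < ϱ) (hp0 : ∀ n, 0 ≤ p n)
    (hq0 : ∀ n, 0 ≤ q n) (hq1 : q 0 = 1)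
    (hrec : ∀ n : ℕ, n * q n = ∑ j ∈ Finset.range (n + 1), p (n - j) * q j) :
    ∀ᶠ n : ℕ in atTop, ϱ / 2 ≤ n * q n := by
  filter_upwards [hp.eventually_const_le (half_lt_self hϱ)] with n hn
  rw [hrec n]
  have := Finset.single_le_sum (f := fun j => p (n - j) * q j) (s := Finset.range (n + 1))
    (fun j _ => mul_nonneg (hp0 _) (hq0 j)) (Finset.mem_range.2 (Nat.succ_pos n))
  simp only [tsub_zero, hq1, mul_one] at this
  linarith

lemma tendsto_sum_atTop (hϱ : 0 < ϱ) (hq0 : ∀ n, 0 ≤ q n)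
    (hq : ∀ᶠ n : ℕ in atTop, ϱ / 2 ≤ n * q n) :
    Tendsto (fun n => ∑ j ∈ Finset.range n, q j) atTop atTop := by
  refine (not_summable_iff_tendsto_nat_atTop_of_nonneg hq0).1 fun hs => ?_
  have h : Summable fun n : ℕ => (n : ℝ)⁻¹ * (ϱ / 2) := by
    refine hs.of_norm_bounded_eventually_nat ?_
    filter_upwards [hq, eventually_gt_atTop 0] with n hn hn0
    have hn' : (0 : ℝ) < n := by exact_mod_cast hn0
    rw [Real.norm_of_nonneg (by positivity), inv_mul_le_iff₀ hn']
    exact hn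
  exact Real.not_summable_natCast_inv ((summable_mul_right_iff (by positivity)).1 h)

/-- Since `p → ϱ` and the partial sums of `q` diverge, the convolution of `p` and `q` is
asymptotically `ϱ` times the partial sums. -/
lemma tendsto_natCast_mul_div_sum (hp : Tendsto p atTop (𝓝 ϱ)) (hpz : p 0 = 0)
    (hq0 : ∀ n, 0 ≤ q n) (hq1 : ∀ n, q n ≤ 1)
    (hrec : ∀ n : ℕ, n * q n = ∑ j ∈ Finset.range (n + 1), p (n - j) * q j)
    (hU : Tendsto (fun n => ∑ j ∈ Finset.range n, q j) atTop atTop) :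
    Tendsto (fun n : ℕ => n * q n / ∑ j ∈ Finset.range n, q j) atTop (𝓝 ϱ) := by
  rw [Metric.tendsto_nhds]
  intro ε hε
  obtain ⟨K, hK⟩ := eventually_atTop.1 (Metric.tendsto_nhds.1 hp (ε / 2) (by positivity))
  obtain ⟨B, hB⟩ := (hp.sub_const ϱ).norm.bddAbove_range
  have hB' : ∀ n, |p n - ϱ| ≤ B := fun n => hB ⟨n, rfl⟩
  have hB0 : 0 ≤ B := (abs_nonneg _).trans (hB' 0)
  filter_upwards [hU.eventually_gt_atTop (B * K / (ε / 2)), hU.eventually_gt_atTop 0,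
    eventually_ge_atTop K] with n h1 h2 h3
  rw [div_lt_iff₀ (by positivity)] at h1
  have hdiff : n * q n - ϱ * ∑ j ∈ Finset.range n, q j =
      ∑ j ∈ Finset.range n, (p (n - j) - ϱ) * q j := by
    rw [hrec, Finset.sum_range_succ, Nat.sub_self, hpz, zero_mul, add_zero, Finset.mul_sum,
      ← Finset.sum_sub_distrib]
    exact Finset.sum_congr rfl fun j _ => by ring
  -- The terms with `n - j ≤ K` number at most `K`, and each is at most `B`.
  have hterm : ∀ j ∈ Finset.range n, |(p (n - j) - ϱ) * q j| ≤
      ε / 2 * q j + if n - K ≤ j then B else 0 := by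
    intro j hj
    rw [abs_mul, abs_of_nonneg (hq0 j)]
    split_ifs with h
    · have h4 := mul_le_mul (hB' (n - j)) (hq1 j) (hq0 j) hB0
      have h5 := mul_nonneg (half_pos hε).le (hq0 j)
      linarith
    · have h4 := hK (n - j) (by omega)
      rw [Real.dist_eq] at h4
      rw [add_zero]
      exact mul_le_mul_of_nonneg_right h4.le (hq0 j)
  have hcount : ∑ j ∈ Finset.range n, (if n - K ≤ j then B else 0) ≤ B * K := by
    rw [← Finset.sum_filter, Finset.sum_const, nsmul_eq_mul, mul_comm]
    have : {j ∈ Finset.range n | n - K ≤ j} = Finset.Ico (n - K) n := by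
      ext j
      simp only [Finset.mem_filter, Finset.mem_range, Finset.mem_Ico]
      omega
    rw [this, Nat.card_Ico, show n - (n - K) = K by omega]
  have habs : |n * q n - ϱ * ∑ j ∈ Finset.range n, q j| < ε * ∑ j ∈ Finset.range n, q j := by
    rw [hdiff]
    refine (Finset.abs_sum_le_sum_abs _ _).trans_lt ((Finset.sum_le_sum hterm).trans_lt ?_)
    rw [Finset.sum_add_distrib, ← Finset.mul_sum]
    linarith
  rw [Real.dist_eq, div_sub' h2.ne', abs_div, abs_of_pos h2, div_lt_iff₀ h2]
  rwa [mul_comm ϱ] at habs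

/-- If `n q(n)` is asymptotically `ϱ` times the sum of the earlier `q(j)`, then `q` is regularly
varying with index `ϱ - 1`. -/
lemma exists_slowlyVarying_of_tendsto (hϱ : 0 < ϱ) (hq : ∀ n, 0 < q n)
    (hU : Tendsto (fun n => ∑ j ∈ Finset.range n, q j) atTop atTop)
    (hlim : Tendsto (fun n : ℕ => n * q n / ∑ j ∈ Finset.range n, q j) atTop (𝓝 ϱ)) :
    ∃ ℓ : ℝ → ℝ, SlowlyVarying ℓ ∧ ∀ n : ℕ, 1 ≤ n → q n = (n : ℝ) ^ (ϱ - 1) * ℓ n := by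
  set U : ℕ → ℝ := fun n => ∑ j ∈ Finset.range n, q j
  set V : ℕ → ℝ := fun n => Real.log (U n) - ϱ * Real.log n
  -- At `n = 0` the power of `n` may vanish, so the value there is set to `1`.
  set L : ℕ → ℝ := fun n => if n = 0 then 1 else (n : ℝ) ^ (1 - ϱ) * q n
  have hUpos : ∀ᶠ n in atTop, 0 < U n := hU.eventually_gt_atTop 0
  have hV : Tendsto (fun n : ℕ => n * (V (n + 1) - V n)) atTop (𝓝 0) := by
    have h1 : Tendsto (fun n : ℕ => n * (q n / U n)) atTop (𝓝 ϱ) :=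
      hlim.congr fun n => mul_div_assoc _ _ _
    have h2 := Real.tendsto_nat_mul_log_one_add_of_tendsto h1
    have h3 : Tendsto (fun n : ℕ => n * (1 / (n : ℝ))) atTop (𝓝 1) := by
      refine tendsto_const_nhds.congr' ?_
      filter_upwards [eventually_gt_atTop 0] with n hn
      have : (n : ℝ) ≠ 0 := by positivity
      field_simp
    have h4 := (Real.tendsto_nat_mul_log_one_add_of_tendsto h3).const_mul ϱ
    have h5 := h2.sub h4
    rw [mul_one, sub_self] at h5
    refine h5.congr' ?_
    filter_upwards [hUpos, eventually_gt_atTop 0] with n hn hn0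
    have hn' : (0 : ℝ) < n := by exact_mod_cast hn0
    have h6 : U (n + 1) = U n * (1 + q n / U n) := by
      rw [mul_add, mul_div_cancel₀ _ hn.ne', mul_one]
      exact Finset.sum_range_succ _ _
    have h7 : ((n + 1 : ℕ) : ℝ) = n * (1 + 1 / n) := by
      push_cast
      field_simp
    have h8 : 0 < 1 + q n / U n := by have := div_pos (hq n) hn; linarith
    simp only [V]
    rw [h6, h7, Real.log_mul hn.ne' h8.ne', Real.log_mul hn'.ne' (by positivity)]
    ring
  have hb : Tendsto (fun n : ℕ => Real.log (n * q n / U n)) atTop (𝓝 (Real.log ϱ)) :=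
    hlim.log hϱ.ne'
  refine ⟨fun x => L ⌊x⌋₊, slowlyVarying_floor (fun n => ?_) ?_ hb hV, fun n hn => ?_⟩
  · rcases Nat.eq_zero_or_pos n with rfl | hn
    · simp [L]
    · have hn' : (0 : ℝ) < n := by exact_mod_cast hn
      simp only [L, hn.ne', if_false]
      exact mul_pos (Real.rpow_pos_of_pos hn' _) (hq n)
  · filter_upwards [hUpos, eventually_gt_atTop 0] with n hn hn0
    have hn' : (0 : ℝ) < n := by exact_mod_cast hn0
    have h1 : 0 < (n : ℝ) ^ (1 - ϱ) := Real.rpow_pos_of_pos hn' _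
    simp only [L, hn0.ne', if_false, V]
    rw [← Real.exp_log (mul_pos h1 (hq n)), Real.log_mul h1.ne' (hq n).ne', Real.log_rpow hn',
      Real.log_div (mul_pos hn' (hq n)).ne' hn.ne', Real.log_mul hn'.ne' (hq n).ne']
    congr 1
    ring
  · have hn' : (0 : ℝ) < n := by exact_mod_cast hn
    have hn0 : n ≠ 0 := by omega
    simp only [L, Nat.floor_natCast, hn0, if_false]
    rw [← mul_assoc, ← Real.rpow_add hn']
    simp

end Recursion

/-! ### The exit time -/

lemma lt_exitTime_zero_iff {Ω : Type*} (X : ℕ → Ω → ℝ) (n : ℕ) (ω : Ω) :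
    (n : WithTop ℕ) < exitTime X 0 ω ↔ StaysPositive n fun i => X i ω := by
  rw [exitTime, ← not_le, ← WithTop.coe_natCast, hittingAfter_le_iff]
  simp [StaysPositive, walk, partialSum]

lemma StaysPositive.mono {m n : ℕ} (hmn : m ≤ n) {x : ℕ → ℝ} (h : StaysPositive n x) :
    StaysPositive m x := fun j h1 h2 => h j h1 (h2.trans hmn)

theorem mainTheorem8 {Ω : Type*} [MeasurableSpace Ω] (P : Measure Ω) [IsProbabilityMeasure P]
    (X : ℕ → Ω → ℝ) (hX_meas : ∀ i, Measurable (X i)) (hX_indep : iIndepFun X P)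
    (hX_ident : ∀ i, IdentDistrib (X i) (X 0) P P)
    (ϱ : ℝ) (hϱ_pos : 0 < ϱ) (hϱ_lt_one : ϱ < 1)
    (hlim : Tendsto (fun n : ℕ => P.real {ω | 0 < walk X n ω}) atTop (𝓝 ϱ)) :
    ∃ ℓ : ℝ → ℝ, SlowlyVarying ℓ ∧
      ∀ n : ℕ, 1 ≤ n →
        P.real {ω | (n : WithTop ℕ) < exitTime X 0 ω} = (n : ℝ) ^ (ϱ - 1) * ℓ (n : ℝ) := by
  set q : ℕ → ℝ := recordProb P X
  set p : ℕ → ℝ := fun n => P.real {ω | 0 < partialSum (fun i => X i ω) n}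
  have hqdef : ∀ n, P.real {ω | StaysPositive n fun i => X i ω} = q n :=
    measureReal_staysPositive hX_meas hX_indep hX_ident
  have hp : Tendsto p atTop (𝓝 ϱ) := hlim
  have hrec : ∀ n : ℕ, n * q n = ∑ j ∈ Finset.range (n + 1), p (n - j) * q j :=
    natCast_mul_recordProb hX_meas hX_indep hX_ident
  have hq0 : ∀ n, 0 ≤ q n := fun n => measureReal_nonneg
  have hq1 : ∀ n, q n ≤ 1 := fun n => measureReal_le_one
  have hanti : Antitone q := fun m n hmn => by
    rw [← hqdef m, ← hqdef n]
    exact measureReal_mono fun ω hω => StaysPositive.mono hmn hω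
  have hzero : q 0 = 1 := by simp [q, recordProb, IsRecord]
  have hlow := eventually_le_natCast_mul hp hϱ_pos (fun n => measureReal_nonneg) hq0 hzero hrec
  have hU := tendsto_sum_atTop hϱ_pos hq0 hlow
  have hpos : ∀ n, 0 < q n := fun n => by
    obtain ⟨m, hm, hnm⟩ := (hlow.and (eventually_ge_atTop n)).exists
    have hm0 : q m ≠ 0 := fun h => by
      rw [h, mul_zero] at hm
      linarith
    exact ((hq0 m).lt_of_ne' hm0).trans_le (hanti hnm)
  obtain ⟨ℓ, hℓ, h⟩ := exists_slowlyVarying_of_tendsto hϱ_pos hpos hU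
    (tendsto_natCast_mul_div_sum hp (by simp [p]) hq0 hq1 hrec hU)
  refine ⟨ℓ, hℓ, fun n hn => ?_⟩
  simp only [lt_exitTime_zero_iff]
  rw [hqdef, h n hn]
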